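/- Theorem 2. For an integer $r\ge 1$ and flip parameters $\mathbf a=(a_i)$, sums $\sum_{i=\frac{r+1}{2}}^{r}$ being taken over all integers $i$ with $\frac{r+1}{2}\le i\le r$, let $$R_{r,\mathbf a}(p)=\sum_{i=\frac{r+1}{2}}^{r}\binom{r}{i}\left[(1-a_i)\,p^{i}(1-p)^{r-i}+a_i\,p^{r-i}(1-p)^{i}\right],\qquad p\in\mathbb{R},$$ and let $$\lambda_r(\mathbf a):=R_{r,\mathbf a}'(1/2)=\frac{1}{2^{r-1}}\sum_{i=\frac{r+1}{2}}^{r}\binom{r}{i}(2i-r)(1-2a_i).$$ Let $(a_i)_{i\in\mathbb{N}}$ be a sequence of independent and identically distributed random variables with values almost surely in $[0,1]$, with $\mathbb{E}a_i=1/2$ for each $i$ and $\operatorname{Var}a_1>0$. Define $$b_{ri}:=\binom{r}{i}\frac{2i-r}{2^{r-1}}\quad\text{for integers } \tfrac{r+1}{2}\le i\le r,\qquad s_r:=\sqrt{\sum_{i=\frac{r+1}{2}}^{r}b_{ri}^2}.$$ Then, as $r\to\infty$: 1. $s_r=\Theta(r^{1/4})$; 2. $\lambda_r(\mathbf a)/s_r$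 converges in distribution to the normal distribution $\mathcal N(0,4\operatorname{Var}a_1)$ with mean $0$ and variance $4\operatorname{Var}a_1$; 3. $\operatorname{Var}\lambda_r(\mathbf a)=\Theta(\sqrt r)$. Here $x_r=\Theta(y_r)$ means $\liminf_{r\to\infty}|x_r/y_r|>0$ and $\limsup_{r\to\infty}|x_r/y_r|<\infty$. -/

import Mathlib

open MeasureTheory ProbabilityTheory Filter Asymptotics

noncomputable section

namespace LocalFlip

/-- The possible sizes of a majority in a group of size `r`: the integers `i` with
`(r + 1) / 2 ≤ i ≤ r` (the condition is stated without division). -/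
def majoritySizes (r : ℕ) : Finset ℕ :=
  {i ∈ Finset.range (r + 1) | r + 1 ≤ 2 * i}

/-- The update function `R_{r,a}(p)` of the local flip model with group size `r` and flip
parameters `a`. Only the values `a i` with `i ∈ majoritySizes r` are used. -/
def updateFunction (r : ℕ) (a : ℕ → ℝ) (p : ℝ) : ℝ :=
  ∑ i ∈ majoritySizes r, (r.choose i : ℝ) *
    ((1 - a i) * (p ^ i * (1 - p) ^ (r - i)) + a i * (p ^ (r - i) * (1 - p) ^ i))

/-- The stability parameter `λ_r(a) = R'_{r,a}(1/2)` of the fixed point `1/2`. -/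
def stabilityParameter (r : ℕ) (a : ℕ → ℝ) : ℝ :=
  deriv (updateFunction r a) (1 / 2)

/-- The constants `b_{ri} = (r choose i) (2i - r) / 2^(r-1)`. They are used only for
`i ∈ majoritySizes r`, so that `r ≥ 1` and the exponent is not truncated. -/
def coeff (r i : ℕ) : ℝ :=
  (r.choose i : ℝ) * ((2 * (i : ℝ) - (r : ℝ)) / 2 ^ (r - 1))

/-- The normalisation `s_r = √(∑ b_{ri}²)`. -/
def scale (r : ℕ) : ℝ :=
  √(∑ i ∈ majoritySizes r, coeff r i ^ 2)

theorem hasDerivAt_updateFunction (r : ℕ) (a : ℕ → ℝ) :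
    HasDerivAt (updateFunction r a)
      (∑ i ∈ majoritySizes r, coeff r i * (1 - 2 * a i)) (1 / 2) := by
  unfold updateFunction
  refine HasDerivAt.fun_sum fun i hi => ?_
  obtain ⟨hi1, hi2⟩ := Finset.mem_filter.1 hi
  obtain ⟨j, rfl⟩ : ∃ j, r = i + j := Nat.exists_eq_add_of_le (by
    have := Finset.mem_range.1 hi1; omega)
  obtain ⟨k, rfl⟩ : ∃ k, i = k + 1 := Nat.exists_eq_add_of_le' (by omega)
  have hp (m : ℕ) : HasDerivAt (fun p : ℝ => p ^ m) (m * (1 / 2 : ℝ) ^ (m - 1)) (1 / 2) :=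
    hasDerivAt_pow m _
  have hq (m : ℕ) : HasDerivAt (fun p : ℝ => (1 - p) ^ m)
      (-(m * (1 / 2 : ℝ) ^ (m - 1))) (1 / 2) := by
    refine (((hasDerivAt_id' (1 / 2 : ℝ)).const_sub 1).fun_pow m).congr_deriv ?_
    norm_num
  have key := ((((hp (k + 1)).fun_mul (hq j)).const_mul (1 - a (k + 1))).fun_add
    (((hp j).fun_mul (hq (k + 1))).const_mul (a (k + 1)))).const_mul
      ((k + 1 + j).choose (k + 1) : ℝ)
  have hsub : k + 1 + j - (k + 1) = j := by omega
  rw [hsub]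
  refine key.congr_deriv ?_
  unfold coeff
  have h1 : k + 1 + j - 1 = k + j := by omega
  have h2 : (1 : ℝ) - 1 / 2 = 1 / 2 := by norm_num
  rw [h1, h2]
  rcases j with _ | l
  · simp
    field_simp
    ring
  · simp only [Nat.add_sub_cancel]
    push_cast
    simp only [one_div, inv_pow]
    field_simp
    ring

/-- The explicit form of the stability parameter:
`λ_r(a) = 2^{-(r-1)} ∑ (r choose i) (2i - r) (1 - 2 a_i)`. -/
theorem stabilityParameter_eq (r : ℕ) (a : ℕ → ℝ) :
    stabilityParameter r a = ∑ i ∈ majoritySizes r, coeff r i * (1 - 2 * a i) :=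
  (hasDerivAt_updateFunction r a).deriv

end LocalFlip

end

/-!
Up to the factor `r`, the coefficient `b_{ri}` is the difference of two consecutive binomial
probabilities for `r - 1` fair tosses. Hence Vandermonde's identity collapses `s_r²` to `r` times
the probability of a tie in `2 (r - 1)` tosses, which the Wallis product squeezes between constant
multiples of `r ^ (-1/2)`, and a telescoping sum bounds every `b_{ri}` by `√8`.

Centring the flip parameters gives `λ_r(a) = ∑ -2 b_{ri} (a_i - 1/2)`, a sum of independent terms,
whose variance is therefore `4 s_r² Var a_1`. After division by `s_r` the weights tend to zero
uniformly, and the characteristic functions of `a_1 - 1/2` and of the Gaussian with the same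
variance agree to second order at `0`. Since a product of numbers in the closed unit disc moves by
at most the sum of the changes of its factors, the factors of the characteristic function of
`λ_r(a) / s_r` may be replaced by Gaussian ones in the limit.
-/

open scoped NNReal Topology

namespace LocalFlip

/-- The probability that `n` tosses of a fair coin show exactly `k` heads. The coefficients
`coeff r i` are `r` times its discrete differences, see `coeff_succ_succ`. -/
noncomputable def fairBinomial (n k : ℕ) : ℝ :=
  n.choose k / 2 ^ n

theorem fairBinomial_nonneg (n k : ℕ) : 0 ≤ fairBinomial n k := by
  unfold fairBinomial
  positivity

theorem fairBinomial_le_middle (n k : ℕ) : fairBinomial n k ≤ fairBinomial n (n / 2) := by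
  unfold fairBinomial
  gcongr
  exact Nat.choose_le_middle k n

theorem fairBinomial_sub {n k : ℕ} (hk : k ≤ n) : fairBinomial n (n - k) = fairBinomial n k := by
  rw [fairBinomial, Nat.choose_symm hk, fairBinomial]

theorem fairBinomial_succ_succ (n k : ℕ) :
    fairBinomial (n + 1) (k + 1) = (fairBinomial n k + fairBinomial n (k + 1)) / 2 := by
  simp only [fairBinomial, Nat.choose_succ_succ, Nat.cast_add, pow_succ]
  field_simp

theorem sum_fairBinomial_sq (n : ℕ) :
    ∑ k ∈ Finset.range (n + 1), fairBinomial n k ^ 2 = fairBinomial (2 * n) n := by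
  have h : ∑ k ∈ Finset.range (n + 1), (n.choose k : ℝ) ^ 2 = (2 * n).choose n := by
    exact_mod_cast Nat.sum_range_choose_sq n
  simp only [fairBinomial, div_pow, ← Finset.sum_div, h, ← pow_mul, mul_comm]

theorem sum_fairBinomial_mul_succ (n : ℕ) :
    ∑ k ∈ Finset.range (n + 1), fairBinomial n k * fairBinomial n (k + 1) =
      fairBinomial (2 * n) (n + 1) := by
  have vandermonde :
      ∑ k ∈ Finset.range (n + 1), n.choose k * n.choose (k + 1) = (2 * n).choose (n + 1) := by
    rw [two_mul, Nat.add_choose_eq, Finset.Nat.sum_antidiagonal_eq_sum_range_succ_mk,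
      Finset.sum_range_succ _ (n + 1), Nat.choose_succ_self, zero_mul, add_zero, ← Finset.sum_flip]
    refine Finset.sum_congr rfl fun k hk => ?_
    have hk : k ≤ n := Finset.mem_range_succ_iff.1 hk
    rw [Nat.choose_symm hk, Nat.sub_add_comm hk]
  have h : ∑ k ∈ Finset.range (n + 1), (n.choose k : ℝ) * n.choose (k + 1) =
      (2 * n).choose (n + 1) := by
    exact_mod_cast vandermonde
  simp only [fairBinomial, div_mul_div_comm, ← Finset.sum_div, h, ← pow_add, two_mul]

theorem succ_mul_fairBinomial_two_mul_succ (n : ℕ) :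
    ((n : ℝ) + 1) * fairBinomial (2 * n) (n + 1) = n * fairBinomial (2 * n) n := by
  have h : ((2 * n).choose (n + 1) : ℝ) * (n + 1) = (2 * n).choose n * n := by
    have := Nat.choose_succ_right_eq (2 * n) n
    rw [two_mul, Nat.add_sub_cancel] at this
    rw [two_mul]
    exact_mod_cast this
  unfold fairBinomial
  linear_combination h / 2 ^ (2 * n)

theorem succ_mul_fairBinomial_central_succ (n : ℕ) :
    2 * ((n : ℝ) + 1) * fairBinomial (2 * (n + 1)) (n + 1) =
      (2 * n + 1) * fairBinomial (2 * n) n := by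
  have h : ((n : ℝ) + 1) * (2 * (n + 1)).choose (n + 1) =
      2 * (2 * n + 1) * (2 * n).choose n := by
    exact_mod_cast Nat.succ_mul_centralBinom_succ n
  rw [fairBinomial, fairBinomial, mul_add 2 n 1, pow_add]
  linear_combination h / (2 * 2 ^ (2 * n))

theorem one_le_wallisProduct (n : ℕ) : 1 ≤ Real.Wallis.W n := by
  induction n with
  | zero => simp [Real.Wallis.W]
  | succ n ih =>
    rw [Real.Wallis.W_succ]
    refine one_le_mul_of_one_le_of_one_le ih ?_
    rw [div_mul_div_comm, one_le_div (by positivity)]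
    nlinarith

theorem fairBinomial_central_sq (n : ℕ) :
    fairBinomial (2 * n) n ^ 2 = 1 / ((2 * n + 1) * Real.Wallis.W n) := by
  have h : ((2 * n).choose n : ℝ) * (n.factorial * n.factorial) = (2 * n).factorial := by
    have := Nat.add_choose_mul_factorial_mul_factorial n n
    rw [← two_mul, mul_assoc] at this
    exact_mod_cast this
  have := n.factorial_pos
  have := (Nat.choose_pos (Nat.le_mul_of_pos_left n two_pos))
  rw [Real.Wallis.W_eq_factorial_ratio, fairBinomial, ← h]
  field_simp
  ring

theorem fairBinomial_central_sq_mul_le_one (n : ℕ) :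
    fairBinomial (2 * n) n ^ 2 * (2 * n + 1) ≤ 1 := by
  have hW := one_le_wallisProduct n
  rw [fairBinomial_central_sq, div_mul_eq_mul_div, div_le_one (by positivity), one_mul]
  exact le_mul_of_one_le_right (by positivity) hW

theorem fairBinomial_two_mul_succ_central (n : ℕ) :
    fairBinomial (2 * (n + 1)) (n + 1) = fairBinomial (2 * n + 1) n := by
  have hsymm : fairBinomial (2 * n + 1) (n + 1) = fairBinomial (2 * n + 1) n := by
    rw [fairBinomial, Nat.choose_symm_half, fairBinomial]
  rw [mul_add_one, fairBinomial_succ_succ, hsymm, add_self_div_two]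

theorem fairBinomial_sq_mul_succ_le_one (n k : ℕ) : fairBinomial n k ^ 2 * (n + 1) ≤ 1 := by
  suffices h : fairBinomial n (n / 2) ^ 2 * (n + 1) ≤ 1 by
    refine le_trans ?_ h
    gcongr
    · exact fairBinomial_nonneg n k
    · exact fairBinomial_le_middle n k
  obtain ⟨m, rfl | rfl⟩ := Nat.even_or_odd' n
  · rw [Nat.mul_div_cancel_left m two_pos]
    exact_mod_cast fairBinomial_central_sq_mul_le_one m
  · have h := fairBinomial_central_sq_mul_le_one (m + 1)
    rw [fairBinomial_two_mul_succ_central] at h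
    rw [show (2 * m + 1) / 2 = m by omega]
    refine le_trans ?_ h
    gcongr
    push_cast
    linarith

theorem coeff_succ (n i : ℕ) :
    coeff (n + 1) i = 2 * fairBinomial (n + 1) i * (2 * i - (n + 1)) := by
  rw [coeff, fairBinomial, Nat.add_sub_cancel, pow_succ]
  push_cast
  field_simp

theorem coeff_succ_succ (n k : ℕ) :
    coeff (n + 1) (k + 1) = (n + 1) * (fairBinomial n k - fairBinomial n (k + 1)) := by
  have absorb : ((n : ℝ) + 1) * n.choose k = (n + 1).choose (k + 1) * (k + 1) := by
    exact_mod_cast Nat.add_one_mul_choose_eq n k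
  have pascal : ((n + 1).choose (k + 1) : ℝ) = n.choose k + n.choose (k + 1) := by
    exact_mod_cast Nat.choose_succ_succ n k
  simp only [coeff, fairBinomial, Nat.add_sub_cancel]
  push_cast
  field_simp
  linear_combination (-2) * absorb - (n + 1) * pascal

theorem sum_range_eq_two_nsmul_sum_majoritySizes {M : Type*} [AddCommMonoid M] {r : ℕ}
    {f : ℕ → M} (hsymm : ∀ i ≤ r, f (r - i) = f i) (hmid : ∀ i, 2 * i = r → f i = 0) :
    ∑ i ∈ Finset.range (r + 1), f i = 2 • ∑ i ∈ majoritySizes r, f i := by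
  let g (i : ℕ) : M := if r + 1 ≤ 2 * i then f i else 0
  have hfg : ∀ i ∈ Finset.range (r + 1), f i = g i + g (r - i) := by
    intro i hi
    have hi : i ≤ r := Finset.mem_range_succ_iff.1 hi
    simp only [g, hsymm i hi]
    rcases lt_trichotomy (2 * i) r with h | h | h
    · rw [if_neg (by omega), if_pos (by omega), zero_add]
    · simp only [hmid i h, ite_self, add_zero]
    · rw [if_pos (by omega), if_neg (by omega), add_zero]
  rw [Finset.sum_congr rfl hfg, Finset.sum_add_distrib, Finset.sum_flip, ← two_nsmul,
    majoritySizes, Finset.sum_filter]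

theorem sum_range_coeff_sq (n : ℕ) :
    ∑ i ∈ Finset.range (n + 2), coeff (n + 1) i ^ 2 = 2 * ((n + 1) * fairBinomial (2 * n) n) := by
  have hcoeff : ∀ k, coeff (n + 1) (k + 1) ^ 2 = 4 * ((n : ℝ) + 1) ^ 2 *
      (fairBinomial (n + 1) (k + 1) ^ 2 - fairBinomial n k * fairBinomial n (k + 1)) := by
    intro k
    rw [coeff_succ_succ, fairBinomial_succ_succ]
    ring
  have hzero : coeff (n + 1) 0 ^ 2 = 4 * ((n : ℝ) + 1) ^ 2 * fairBinomial (n + 1) 0 ^ 2 := by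
    rw [coeff_succ]
    push_cast
    ring
  calc ∑ i ∈ Finset.range (n + 2), coeff (n + 1) i ^ 2
      = 4 * ((n : ℝ) + 1) ^ 2 *
          (∑ i ∈ Finset.range (n + 2), fairBinomial (n + 1) i ^ 2 -
            ∑ k ∈ Finset.range (n + 1), fairBinomial n k * fairBinomial n (k + 1)) := by
        rw [Finset.sum_range_succ', Finset.sum_range_succ' (fun i => fairBinomial (n + 1) i ^ 2),
          hzero, Finset.sum_congr rfl fun k _ => hcoeff k, ← Finset.mul_sum,
          Finset.sum_sub_distrib]
        ring
    _ = 4 * ((n : ℝ) + 1) ^ 2 *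
          (fairBinomial (2 * (n + 1)) (n + 1) - fairBinomial (2 * n) (n + 1)) := by
        rw [sum_fairBinomial_sq, sum_fairBinomial_mul_succ]
    _ = 2 * ((n + 1) * fairBinomial (2 * n) n) := by
        linear_combination 2 * ((n : ℝ) + 1) * succ_mul_fairBinomial_central_succ n -
          4 * ((n : ℝ) + 1) * succ_mul_fairBinomial_two_mul_succ n

theorem scale_sq (r : ℕ) : scale r ^ 2 = ∑ i ∈ majoritySizes r, coeff r i ^ 2 :=
  Real.sq_sqrt (Finset.sum_nonneg fun _ _ => sq_nonneg _)

theorem scale_succ_sq (n : ℕ) : scale (n + 1) ^ 2 = (n + 1) * fairBinomial (2 * n) n := by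
  have hsymm : ∀ i ≤ n + 1, coeff (n + 1) (n + 1 - i) ^ 2 = coeff (n + 1) i ^ 2 := by
    intro i hi
    rw [coeff_succ, coeff_succ, fairBinomial_sub hi, Nat.cast_sub hi]
    push_cast
    ring
  have hmid : ∀ i, 2 * i = n + 1 → coeff (n + 1) i ^ 2 = 0 := by
    intro i hi
    have hi : (2 : ℝ) * i = n + 1 := by exact_mod_cast hi
    rw [coeff_succ, hi]
    ring
  have h := sum_range_coeff_sq n
  rw [sum_range_eq_two_nsmul_sum_majoritySizes hsymm hmid, ← scale_sq, two_nsmul] at h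
  linarith

theorem scale_succ_pow_four (n : ℕ) :
    scale (n + 1) ^ 4 = (n + 1) ^ 2 / ((2 * n + 1) * Real.Wallis.W n) := by
  rw [show 4 = 2 * 2 from rfl, pow_mul, scale_succ_sq, mul_pow, fairBinomial_central_sq,
    mul_one_div]

theorem scale_zero : scale 0 = 0 := by
  simp [scale, majoritySizes, Finset.filter_singleton]

theorem scale_pow_four_le (r : ℕ) : scale r ^ 4 ≤ r := by
  cases r with
  | zero => simp [scale_zero]
  | succ n =>
    have hW := one_le_wallisProduct n
    rw [scale_succ_pow_four, div_le_iff₀ (by positivity)]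
    push_cast
    calc ((n : ℝ) + 1) ^ 2
        ≤ (n + 1) * ((2 * n + 1) * 1) := by nlinarith [(n.cast_nonneg : (0 : ℝ) ≤ n)]
      _ ≤ (n + 1) * ((2 * n + 1) * Real.Wallis.W n) := by gcongr

theorem div_pi_le_scale_pow_four (r : ℕ) : r / Real.pi ≤ scale r ^ 4 := by
  cases r with
  | zero => simp [scale_zero]
  | succ n =>
    have hW := Real.Wallis.W_le n
    have hW0 := Real.Wallis.W_pos n
    rw [scale_succ_pow_four, div_le_div_iff₀ Real.pi_pos (by positivity)]
    push_cast
    nlinarith [Real.pi_pos]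

theorem scale_nonneg (r : ℕ) : 0 ≤ scale r :=
  Real.sqrt_nonneg _

theorem scale_pos {r : ℕ} (hr : r ≠ 0) : 0 < scale r := by
  have h : 0 < scale r ^ 4 := lt_of_lt_of_le (by positivity) (div_pi_le_scale_pow_four r)
  exact (scale_nonneg r).lt_of_ne' fun h0 => by simp [h0] at h

theorem scale_isTheta_rpow :
    scale =Θ[atTop] fun r : ℕ => (r : ℝ) ^ (1 / 4 : ℝ) := by
  have hroot : ∀ r : ℕ, ((r : ℝ) ^ (1 / 4 : ℝ)) ^ 4 = r := fun r => by
    rw [← Real.rpow_mul_natCast r.cast_nonneg]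
    norm_num
  constructor
  · refine IsBigO.of_pow four_ne_zero (IsBigO.of_norm_le fun r => ?_)
    simpa only [Pi.pow_apply, hroot, norm_pow, Real.norm_of_nonneg (scale_nonneg r)]
      using scale_pow_four_le r
  · refine IsBigO.of_pow four_ne_zero
      (IsBigO.of_bound Real.pi (Eventually.of_forall fun r => ?_))
    have h := div_pi_le_scale_pow_four r
    rw [div_le_iff₀' Real.pi_pos] at h
    simpa only [Pi.pow_apply, hroot, norm_pow, Real.norm_of_nonneg (scale_nonneg r),
      Real.norm_natCast] using h

theorem scale_sq_isTheta_sqrt : (fun r => scale r ^ 2) =Θ[atTop] fun r : ℕ => √(r : ℝ) := by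
  refine (scale_isTheta_rpow.pow 2).trans_eventuallyEq (Eventually.of_forall fun r => ?_)
  change ((r : ℝ) ^ (1 / 4 : ℝ)) ^ 2 = √(r : ℝ)
  rw [← Real.rpow_mul_natCast r.cast_nonneg, Real.sqrt_eq_rpow]
  norm_num

theorem tendsto_scale_atTop : Tendsto scale atTop atTop := by
  have hrpow : Tendsto (fun r : ℕ => (r : ℝ) ^ (1 / 4 : ℝ)) atTop atTop :=
    (tendsto_rpow_atTop (by norm_num)).comp tendsto_natCast_atTop_atTop
  refine (scale_isTheta_rpow.tendsto_norm_atTop_iff.2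
    (tendsto_norm_atTop_atTop.comp hrpow)).congr fun r => ?_
  exact Real.norm_of_nonneg (scale_nonneg r)

theorem fairBinomial_succ_le {n k : ℕ} (h : n ≤ 2 * k + 1) :
    fairBinomial n (k + 1) ≤ fairBinomial n k := by
  have hsign : (0 : ℝ) ≤ 2 * ↑(k + 1) - (n + 1) := by
    rw [sub_nonneg]
    exact_mod_cast (by omega : n + 1 ≤ 2 * (k + 1))
  have hdiff : 0 ≤ ((n : ℝ) + 1) * (fairBinomial n k - fairBinomial n (k + 1)) := by
    rw [← coeff_succ_succ, coeff_succ]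
    have := fairBinomial_nonneg (n + 1) (k + 1)
    positivity
  exact sub_nonneg.1 (nonneg_of_mul_nonneg_right hdiff (by positivity))

/- Beyond the middle `fairBinomial (n + 1)` decreases, so in passing to the next `k` the left-hand
side grows by at most four times the new coefficient, and by `coeff_succ_succ` these increments
telescope to the right-hand side. -/
theorem coeff_mul_two_mul_sub_le {n k : ℕ} (hk : n / 2 ≤ k) :
    coeff (n + 1) (k + 1) * (2 * ↑(k + 1) - (n + 1)) ≤
      4 * (n + 1) * (fairBinomial n (n / 2) - fairBinomial n (k + 1)) := by
  induction k, hk using Nat.le_induction with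
  | base =>
    have hdist : (2 * ↑(n / 2 + 1) - (n + 1) : ℝ) ≤ 1 := by
      rw [sub_le_iff_le_add]
      exact_mod_cast (by omega : 2 * (n / 2 + 1) ≤ 1 + (n + 1))
    have hdiff := sub_nonneg.2 (fairBinomial_succ_le (by omega : n ≤ 2 * (n / 2) + 1))
    have hcoeff : 0 ≤ coeff (n + 1) (n / 2 + 1) := by
      rw [coeff_succ_succ]
      positivity
    calc coeff (n + 1) (n / 2 + 1) * (2 * ↑(n / 2 + 1) - (n + 1))
        ≤ coeff (n + 1) (n / 2 + 1) * 4 := by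
          gcongr
          linarith
      _ = 4 * (n + 1) * (fairBinomial n (n / 2) - fairBinomial n (n / 2 + 1)) := by
          rw [coeff_succ_succ]
          ring
  | succ k hk ih =>
    have hdist : (0 : ℝ) ≤ 2 * ↑(k + 1) - (n + 1) := by
      rw [sub_nonneg]
      exact_mod_cast (by omega : n + 1 ≤ 2 * (k + 1))
    have hmono := fairBinomial_succ_le (by omega : n + 1 ≤ 2 * (k + 1) + 1)
    have hnonneg := fairBinomial_nonneg (n + 1) (k + 2)
    have hcast : (2 * ↑(k + 2) - (n + 1) : ℝ) = 2 * ↑(k + 1) - (n + 1) + 2 := by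
      push_cast
      ring
    have hstep : coeff (n + 1) (k + 2) * (2 * ↑(k + 2) - (n + 1)) -
        coeff (n + 1) (k + 1) * (2 * ↑(k + 1) - (n + 1)) ≤ 4 * coeff (n + 1) (k + 2) := by
      rw [coeff_succ, coeff_succ, hcast]
      set d : ℝ := 2 * ↑(k + 1) - (n + 1)
      nlinarith [mul_le_mul_of_nonneg_right hmono (sq_nonneg d)]
    have htelescope : coeff (n + 1) (k + 2) =
        (n + 1) * (fairBinomial n (k + 1) - fairBinomial n (k + 2)) :=
      coeff_succ_succ n (k + 1)
    linear_combination ih + hstep + 4 * htelescope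

theorem coeff_sq_le {r i : ℕ} (hi : i ∈ majoritySizes r) : coeff r i ^ 2 ≤ 8 := by
  simp only [majoritySizes, Finset.mem_filter, Finset.mem_range] at hi
  obtain ⟨n, rfl⟩ : ∃ n, r = n + 1 := Nat.exists_eq_add_of_le' (by omega)
  obtain ⟨k, rfl⟩ : ∃ k, i = k + 1 := Nat.exists_eq_add_of_le' (by omega)
  set b := fairBinomial n (n / 2)
  have hb : 0 ≤ b := fairBinomial_nonneg n _
  have hweight : fairBinomial (n + 1) (k + 1) ≤ b := by
    rw [fairBinomial_succ_succ]
    linarith [fairBinomial_le_middle n k, fairBinomial_le_middle n (k + 1)]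
  have hmul : coeff (n + 1) (k + 1) * (2 * ↑(k + 1) - (n + 1)) ≤ 4 * (n + 1) * b := by
    refine (coeff_mul_two_mul_sub_le (by omega)).trans ?_
    gcongr
    exact sub_le_self _ (fairBinomial_nonneg _ _)
  calc coeff (n + 1) (k + 1) ^ 2
      = 2 * fairBinomial (n + 1) (k + 1) *
          (coeff (n + 1) (k + 1) * (2 * ↑(k + 1) - (n + 1))) := by
        rw [coeff_succ]
        ring
    _ ≤ 2 * fairBinomial (n + 1) (k + 1) * (4 * (n + 1) * b) := by
        have := fairBinomial_nonneg (n + 1) (k + 1)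
        gcongr
    _ ≤ 2 * b * (4 * (n + 1) * b) := by gcongr
    _ = 8 * (b ^ 2 * (n + 1)) := by ring
    _ ≤ 8 := by linarith [fairBinomial_sq_mul_succ_le_one n (n / 2)]

theorem sum_neg_two_mul_coeff_sq (r : ℕ) :
    ∑ i ∈ majoritySizes r, (-2 * coeff r i) ^ 2 = 4 * scale r ^ 2 := by
  rw [scale_sq, Finset.mul_sum]
  exact Finset.sum_congr rfl fun i _ => by ring

theorem eventually_abs_neg_two_mul_coeff_div_scale_lt :
    ∀ δ > 0, ∀ᶠ r in atTop, ∀ i ∈ majoritySizes r, |-2 * coeff r i / scale r| < δ := by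
  intro δ hδ
  have hlim : Tendsto (fun r => 2 * √8 / scale r) atTop (𝓝 0) :=
    tendsto_scale_atTop.const_div_atTop _
  filter_upwards [hlim.eventually_lt_const hδ] with r hr i hi
  refine lt_of_le_of_lt ?_ hr
  rw [abs_div, abs_mul, abs_neg, abs_two, abs_of_nonneg (scale_nonneg r)]
  have := Real.abs_le_sqrt (coeff_sq_le hi)
  have := scale_nonneg r
  gcongr

theorem tendsto_sum_neg_two_mul_coeff_div_scale_sq :
    Tendsto (fun r => ∑ i ∈ majoritySizes r, (-2 * coeff r i / scale r) ^ 2) atTop (𝓝 4) := by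
  refine tendsto_const_nhds.congr' ?_
  filter_upwards [eventually_ne_atTop 0] with r hr
  have := (scale_pos hr).ne'
  simp only [div_pow, ← Finset.sum_div, sum_neg_two_mul_coeff_sq]
  field_simp

theorem norm_prod_sub_prod_le {ι R : Type*} [NormedCommRing R] [NormOneClass R] (s : Finset ι)
    {f g : ι → R} (hf : ∀ i ∈ s, ‖f i‖ ≤ 1) (hg : ∀ i ∈ s, ‖g i‖ ≤ 1) :
    ‖∏ i ∈ s, f i - ∏ i ∈ s, g i‖ ≤ ∑ i ∈ s, ‖f i - g i‖ := by
  induction s using Finset.cons_induction with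
  | empty => simp
  | cons j s hj ih =>
    simp only [Finset.forall_mem_cons] at hf hg
    rw [Finset.prod_cons, Finset.prod_cons, Finset.sum_cons]
    have hprod : ‖∏ i ∈ s, g i‖ ≤ 1 :=
      (Finset.norm_prod_le s g).trans (Finset.prod_le_one (fun _ _ => norm_nonneg _) hg.2)
    calc ‖f j * ∏ i ∈ s, f i - g j * ∏ i ∈ s, g i‖
        = ‖(f j - g j) * ∏ i ∈ s, g i + f j * (∏ i ∈ s, f i - ∏ i ∈ s, g i)‖ := by
          congr 1
          ring
      _ ≤ ‖f j - g j‖ * ‖∏ i ∈ s, g i‖ + ‖f j‖ * ‖∏ i ∈ s, f i - ∏ i ∈ s, g i‖ :=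
          (norm_add_le _ _).trans (add_le_add (norm_mul_le _ _) (norm_mul_le _ _))
      _ ≤ ‖f j - g j‖ * 1 + 1 * ∑ i ∈ s, ‖f i - g i‖ := by
          gcongr
          · exact hf.1
          · exact ih hf.2 hg.2
      _ = ‖f j - g j‖ + ∑ i ∈ s, ‖f i - g i‖ := by rw [mul_one, one_mul]

theorem tendsto_prod_sub_prod_of_isLittleO {α ι E R : Type*} [SeminormedAddCommGroup E]
    [NormedCommRing R] [NormOneClass R] {l : Filter α} {φ ψ : E → R} (hφ : ∀ u, ‖φ u‖ ≤ 1)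
    (hψ : ∀ u, ‖ψ u‖ ≤ 1) {p : ℕ} (hφψ : (fun u => φ u - ψ u) =o[𝓝 0] fun u => ‖u‖ ^ p)
    {s : α → Finset ι} {c : α → ι → E}
    (hsmall : ∀ δ > 0, ∀ᶠ n in l, ∀ i ∈ s n, ‖c n i‖ < δ) {C : ℝ}
    (hbound : ∀ᶠ n in l, ∑ i ∈ s n, ‖c n i‖ ^ p ≤ C) :
    Tendsto (fun n => ∏ i ∈ s n, φ (c n i) - ∏ i ∈ s n, ψ (c n i)) l (𝓝 0) := by
  rw [Metric.tendsto_nhds]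
  intro ε hε
  obtain ⟨η, hη, hηC⟩ : ∃ η > 0, η * C < ε := exists_pos_mul_lt hε C |>.imp fun η h => by
    rwa [mul_comm η]
  obtain ⟨δ, hδ, hball⟩ := Metric.eventually_nhds_iff.1 (hφψ.def hη)
  filter_upwards [hsmall δ hδ, hbound] with n hn hC
  have hterm : ∀ i ∈ s n, ‖φ (c n i) - ψ (c n i)‖ ≤ η * ‖c n i‖ ^ p := fun i hi => by
    simpa using hball (y := c n i) (by simpa using hn i hi)
  calc dist (∏ i ∈ s n, φ (c n i) - ∏ i ∈ s n, ψ (c n i)) 0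
      = ‖∏ i ∈ s n, φ (c n i) - ∏ i ∈ s n, ψ (c n i)‖ := dist_zero_right _
    _ ≤ ∑ i ∈ s n, ‖φ (c n i) - ψ (c n i)‖ :=
        norm_prod_sub_prod_le _ (fun _ _ => hφ _) fun _ _ => hψ _
    _ ≤ η * ∑ i ∈ s n, ‖c n i‖ ^ p := by
        rw [Finset.mul_sum]
        exact Finset.sum_le_sum hterm
    _ ≤ η * C := by gcongr
    _ < ε := hηC

theorem charFun_sub_charFun_isLittleO_pow {μ ν : Measure ℝ} [IsFiniteMeasure μ]
    [IsFiniteMeasure ν] {n : ℕ} (hμ : MemLp id n μ) (hν : MemLp id n ν)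
    (hmoment : ∀ k ≤ n, ∫ x, x ^ k ∂μ = ∫ x, x ^ k ∂ν) :
    (fun t => charFun μ t - charFun ν t) =o[𝓝 0] fun t => t ^ n := by
  have htaylor : ∀ (ρ : Measure ℝ) [IsFiniteMeasure ρ], MemLp id n ρ →
      (fun t => charFun ρ t - ∑ k ∈ Finset.range (n + 1),
        (k.factorial : ℂ)⁻¹ * (t * Complex.I) ^ k * ∫ x, x ^ k ∂ρ) =o[𝓝 0] fun t => t ^ n := by
    intro ρ _ hρ
    have h := taylor_isLittleO_univ (f := charFun ρ) (x₀ := 0) (n := n) (contDiff_charFun hρ)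
    simpa only [taylorWithinEval_charFun_zero hρ, sub_zero] using h
  refine ((htaylor μ hμ).sub (htaylor ν hν)).congr_left fun t => ?_
  have hsum : ∀ k ∈ Finset.range (n + 1),
      (k.factorial : ℂ)⁻¹ * (t * Complex.I) ^ k * ((∫ x, x ^ k ∂μ : ℝ) : ℂ) =
        (k.factorial : ℂ)⁻¹ * (t * Complex.I) ^ k * ((∫ x, x ^ k ∂ν : ℝ) : ℂ) := fun k hk => by
    rw [hmoment k (Finset.mem_range_succ_iff.1 hk)]
  rw [Finset.sum_congr rfl hsum, sub_sub_sub_cancel_right]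

theorem tendsto_prod_charFun_gaussianReal {α ι : Type*} {l : Filter α} {s : α → Finset ι}
    {c : α → ι → ℝ} {w : ℝ≥0} (hc : Tendsto (fun n => ∑ i ∈ s n, c n i ^ 2) l (𝓝 w))
    (v : ℝ≥0) (t : ℝ) :
    Tendsto (fun n => ∏ i ∈ s n, charFun (gaussianReal 0 v) (c n i * t)) l
      (𝓝 (charFun (gaussianReal 0 (w * v)) t)) := by
  have hchar : ∀ (v : ℝ≥0) (u : ℝ),
      charFun (gaussianReal 0 v) u = Complex.exp ((-(v * u ^ 2 / 2) : ℝ) : ℂ) := fun v u => by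
    rw [charFun_gaussianReal]
    congr 1
    push_cast
    ring
  have hexponent : ∀ n, ∑ i ∈ s n, -(v * (c n i * t) ^ 2 / 2) =
      (∑ i ∈ s n, c n i ^ 2) * -(v * t ^ 2 / 2) := fun n => by
    rw [Finset.sum_mul]
    exact Finset.sum_congr rfl fun i _ => by ring
  simp only [hchar, ← Complex.exp_sum, ← Complex.ofReal_sum, hexponent]
  have hlimit : -(↑(w * v) * t ^ 2 / 2) = (w : ℝ) * -(v * t ^ 2 / 2) := by
    push_cast
    ring
  rw [hlimit]
  exact ((Complex.continuous_exp.comp Complex.continuous_ofReal).tendsto _).comp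
    (hc.mul_const (-(v * t ^ 2 / 2)))

section IdentDistrib

variable {Ω Ω' : Type*} [MeasurableSpace Ω] [MeasurableSpace Ω'] {μ : Measure Ω}
  {ν : Measure Ω'} {Y : Ω' → ℝ}

theorem charFun_map_sub_charFun_gaussianReal_isLittleO [IsProbabilityMeasure ν]
    (hY : MemLp Y 2 ν) (hmean : ∫ ω, Y ω ∂ν = 0) :
    (fun t => charFun (ν.map Y) t - charFun (gaussianReal 0 (variance Y ν).toNNReal) t)
      =o[𝓝 0] fun t => t ^ 2 := by
  have hYm : AEMeasurable Y ν := hY.aemeasurable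
  have : IsProbabilityMeasure (ν.map Y) := Measure.isProbabilityMeasure_map hYm
  set v := (variance Y ν).toNNReal with hv
  have hfirst : ∫ x, x ∂(ν.map Y) = ∫ x, x ∂(gaussianReal 0 v) := by
    rw [integral_map hYm (by fun_prop), hmean, integral_id_gaussianReal]
  have hsecond : ∫ x, x ^ 2 ∂(ν.map Y) = ∫ x, x ^ 2 ∂(gaussianReal 0 v) := by
    rw [integral_map hYm (by fun_prop), ← variance_of_integral_eq_zero hYm hmean,
      ← variance_of_integral_eq_zero aemeasurable_id' integral_id_gaussianReal,
      variance_fun_id_gaussianReal, hv, Real.coe_toNNReal _ (variance_nonneg _ _)]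
  refine charFun_sub_charFun_isLittleO_pow
    ((memLp_map_measure_iff aestronglyMeasurable_id hYm).2 hY) (memLp_id_gaussianReal 2) ?_
  intro k hk
  interval_cases k
  · simp
  · simpa only [pow_one] using hfirst
  · exact hsecond

variable {ι : Type*} {X : ι → Ω → ℝ}

theorem charFun_map_sum_mul (hindep : iIndepFun X μ) (hident : ∀ i, IdentDistrib (X i) Y μ ν)
    (s : Finset ι) (c : ι → ℝ) (t : ℝ) :
    charFun (μ.map fun ω => ∑ i ∈ s, c i * X i ω) t =
      ∏ i ∈ s, charFun (ν.map Y) (c i * t) := by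
  have hX : ∀ i, AEMeasurable (X i) μ := fun i => (hident i).aemeasurable_fst
  have hscaled : iIndepFun (fun i ω => c i * X i ω) μ :=
    hindep.comp (fun i x => c i * x) fun i => measurable_const_mul (c i)
  rw [(hscaled.restrict _).charFun_map_fun_finsetSum_eq_prod fun i _ => (hX i).const_mul _,
    Finset.prod_apply]
  exact Finset.prod_congr rfl fun i _ => by rw [charFun_map_mul_comp (hX i), (hident i).map_eq]

theorem variance_sum_mul (hindep : iIndepFun X μ) (hident : ∀ i, IdentDistrib (X i) Y μ ν)
    (hY : MemLp Y 2 ν) (s : Finset ι) (c : ι → ℝ) :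
    variance (fun ω => ∑ i ∈ s, c i * X i ω) μ = (∑ i ∈ s, c i ^ 2) * variance Y ν := by
  have hX : ∀ i, MemLp (X i) 2 μ := fun i => (hident i).memLp_iff.2 hY
  have hscaled : iIndepFun (fun i ω => c i * X i ω) μ :=
    hindep.comp (fun i x => c i * x) fun i => measurable_const_mul (c i)
  have hvar := IndepFun.variance_sum (s := s) (fun i _ => (hX i).const_mul (c i))
    fun i _ j _ hij => hscaled.indepFun hij
  rw [Finset.sum_fn] at hvar
  rw [hvar, Finset.sum_mul]
  exact Finset.sum_congr rfl fun i _ => by rw [variance_const_mul, (hident i).variance_eq]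

theorem tendstoInDistribution_sum_mul [IsProbabilityMeasure μ] [IsProbabilityMeasure ν]
    (hindep : iIndepFun X μ) (hident : ∀ i, IdentDistrib (X i) Y μ ν) (hY : MemLp Y 2 ν)
    (hmean : ∫ ω, Y ω ∂ν = 0) {s : ℕ → Finset ι} {c : ℕ → ι → ℝ} {w : ℝ≥0}
    (hsmall : ∀ δ > 0, ∀ᶠ n in atTop, ∀ i ∈ s n, |c n i| < δ)
    (hc : Tendsto (fun n => ∑ i ∈ s n, c n i ^ 2) atTop (𝓝 w)) :
    TendstoInDistribution (fun n ω => ∑ i ∈ s n, c n i * X i ω) atTop (fun x : ℝ => x)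
      (fun _ => μ) (gaussianReal 0 (w * (variance Y ν).toNNReal)) := by
  have hX : ∀ i, AEMeasurable (X i) μ := fun i => (hident i).aemeasurable_fst
  refine ⟨fun n => Finset.aemeasurable_fun_sum _ fun i _ => (hX i).const_mul _,
    aemeasurable_id', ProbabilityMeasure.tendsto_iff_tendsto_charFun.2 fun t => ?_⟩
  simp only [ProbabilityMeasure.coe_mk, Measure.map_id', charFun_map_sum_mul hindep hident]
  have hbound : ∀ᶠ n in atTop, ∑ i ∈ s n, ‖c n i * t‖ ^ 2 ≤ (w + 1) * t ^ 2 := by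
    filter_upwards [hc.eventually_le_const (lt_add_one (w : ℝ))] with n hn
    simp only [Real.norm_eq_abs, sq_abs, mul_pow, ← Finset.sum_mul]
    gcongr
  have hsmall_mul : ∀ δ > 0, ∀ᶠ n in atTop, ∀ i ∈ s n, ‖c n i * t‖ < δ := by
    intro δ hδ
    obtain ⟨η, hη, hηt⟩ := exists_pos_mul_lt hδ |t|
    filter_upwards [hsmall η hη] with n hn i hi
    rw [norm_mul, Real.norm_eq_abs, Real.norm_eq_abs, mul_comm]
    exact (mul_le_mul_of_nonneg_left (hn i hi).le (abs_nonneg t)).trans_lt hηt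
  have : IsProbabilityMeasure (ν.map Y) := Measure.isProbabilityMeasure_map hY.aemeasurable
  have hlaw := charFun_map_sub_charFun_gaussianReal_isLittleO hY hmean
  have hdiff := tendsto_prod_sub_prod_of_isLittleO norm_charFun_le_one norm_charFun_le_one
    (by simpa only [Real.norm_eq_abs, sq_abs] using hlaw) hsmall_mul hbound
  simpa only [sub_add_cancel, zero_add] using
    hdiff.add (tendsto_prod_charFun_gaussianReal hc (variance Y ν).toNNReal t)

end IdentDistrib

theorem stabilityParameter_eq_sum_mul_sub_half (r : ℕ) (x : ℕ → ℝ) :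
    stabilityParameter r x = ∑ i ∈ majoritySizes r, -2 * coeff r i * (x i - 1 / 2) := by
  rw [stabilityParameter_eq]
  exact Finset.sum_congr rfl fun i _ => by ring

section StabilityParameter

variable {Ω : Type*} [MeasurableSpace Ω] {μ : Measure Ω} [IsProbabilityMeasure μ]
  {a : ℕ → Ω → ℝ}

theorem variance_stabilityParameter (h_indep : iIndepFun a μ)
    (h_ident : ∀ i, IdentDistrib (a i) (a 1) μ μ) (h_mem : MemLp (a 1) 2 μ) (r : ℕ) :
    variance (fun ω => stabilityParameter r fun i => a i ω) μ =
      4 * variance (a 1) μ * scale r ^ 2 := by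
  have hcenter : Measurable fun x : ℝ => x - 1 / 2 := by fun_prop
  simp only [stabilityParameter_eq_sum_mul_sub_half]
  rw [variance_sum_mul (X := fun i ω => a i ω - 1 / 2) (Y := fun ω => a 1 ω - 1 / 2)
      (h_indep.comp _ fun _ => hcenter) (fun i => (h_ident i).comp hcenter)
      (h_mem.sub (memLp_const _)), sum_neg_two_mul_coeff_sq,
    variance_sub_const h_mem.aestronglyMeasurable]
  ring

theorem tendstoInDistribution_stabilityParameter_div_scale (h_indep : iIndepFun a μ)
    (h_ident : ∀ i, IdentDistrib (a i) (a 1) μ μ) (h_mem : MemLp (a 1) 2 μ)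
    (h_mean : ∫ ω, a 1 ω ∂μ = 1 / 2) :
    TendstoInDistribution
      (fun (r : ℕ) (ω : Ω) => stabilityParameter r (fun i => a i ω) / scale r)
      atTop (fun x : ℝ => x) (fun _ : ℕ => μ)
      (gaussianReal 0 (4 * variance (a 1) μ).toNNReal) := by
  have hcenter : Measurable fun x : ℝ => x - 1 / 2 := by fun_prop
  have hmean : ∫ ω, (a 1 ω - 1 / 2) ∂μ = 0 := by
    rw [integral_sub (h_mem.integrable one_le_two) (integrable_const _), h_mean]
    simp
  have h := tendstoInDistribution_sum_mul (X := fun i ω => a i ω - 1 / 2)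
    (Y := fun ω => a 1 ω - 1 / 2) (w := 4)
    (h_indep.comp _ fun _ => hcenter) (fun i => (h_ident i).comp hcenter)
    (h_mem.sub (memLp_const _)) hmean eventually_abs_neg_two_mul_coeff_div_scale_lt
    (mod_cast tendsto_sum_neg_two_mul_coeff_div_scale_sq)
  rw [variance_sub_const h_mem.aestronglyMeasurable] at h
  convert! h using 3 with r ω
  · rw [stabilityParameter_eq_sum_mul_sub_half, Finset.sum_div]
    exact Finset.sum_congr rfl fun i _ => by ring
  · rw [Real.toNNReal_mul zero_le_four, Real.toNNReal_ofNat]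

end StabilityParameter

end LocalFlip

theorem theorem2_general {Ω : Type*} [MeasurableSpace Ω] (μ : Measure Ω)
    [IsProbabilityMeasure μ] (a : ℕ → Ω → ℝ)
    (h_indep : iIndepFun a μ)
    (h_ident : ∀ i, IdentDistrib (a i) (a 1) μ μ)
    (h_mean : ∫ ω, a 1 ω ∂μ = 1 / 2)
    (h_var : 0 < variance (a 1) μ) :
    (fun r : ℕ => LocalFlip.scale r) =Θ[atTop] (fun r : ℕ => (r : ℝ) ^ (1 / 4 : ℝ)) ∧
    TendstoInDistribution
      (fun (r : ℕ) (ω : Ω) =>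
        LocalFlip.stabilityParameter r (fun i => a i ω) / LocalFlip.scale r)
      atTop (fun x : ℝ => x) (fun _ : ℕ => μ)
      (gaussianReal 0 (4 * variance (a 1) μ).toNNReal) ∧
    (fun r : ℕ => variance (fun ω => LocalFlip.stabilityParameter r (fun i => a i ω)) μ)
      =Θ[atTop] (fun r : ℕ => √(r : ℝ)) := by
  -- `variance` takes the junk value `0` when the second moment is infinite.
  have h_mem : MemLp (a 1) 2 μ := by
    by_contra h
    exact h_var.ne' (variance_of_not_memLp (h_ident 1).aemeasurable_fst.aestronglyMeasurable h)
  refine ⟨LocalFlip.scale_isTheta_rpow,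
    LocalFlip.tendstoInDistribution_stabilityParameter_div_scale h_indep h_ident h_mem h_mean, ?_⟩
  simp only [LocalFlip.variance_stabilityParameter h_indep h_ident h_mem]
  exact (isTheta_const_mul_left (by positivity)).2 LocalFlip.scale_sq_isTheta_sqrt

theorem theorem2 {Ω : Type*} [MeasurableSpace Ω] (μ : Measure Ω) [IsProbabilityMeasure μ]
    (a : ℕ → Ω → ℝ)
    (h_indep : iIndepFun a μ)
    (h_ident : ∀ i, IdentDistrib (a i) (a 1) μ μ)
    (h_supp : ∀ i, ∀ᵐ ω ∂μ, a i ω ∈ Set.Icc (0 : ℝ) 1)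
    (h_mean : ∀ i, ∫ ω, a i ω ∂μ = 1 / 2)
    (h_var : 0 < variance (a 1) μ) :
    (fun r : ℕ => LocalFlip.scale r) =Θ[atTop] (fun r : ℕ => (r : ℝ) ^ (1 / 4 : ℝ)) ∧
    TendstoInDistribution
      (fun (r : ℕ) (ω : Ω) =>
        LocalFlip.stabilityParameter r (fun i => a i ω) / LocalFlip.scale r)
      atTop (fun x : ℝ => x) (fun _ : ℕ => μ)
      (gaussianReal 0 (4 * variance (a 1) μ).toNNReal) ∧
    (fun r : ℕ => variance (fun ω => LocalFlip.stabilityParameter r (fun i => a i ω)) μ)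
      =Θ[atTop] (fun r : ℕ => √(r : ℝ)) :=
  theorem2_general μ a h_indep h_ident (h_mean 1) h_var
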